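/- For a probability measure $\mu$ on $\mathbb R$ and $z\in\mathbb C^+=\{\operatorname{Im}z>0\}$ put $G_\mu(z)=\int_{\mathbb R}\frac{d\mu(t)}{z-t}$ and $F_\mu(z)=1/G_\mu(z)$. For $s\in\mathbb R$ let $\mathbb C_s=\{z\in\mathbb C:\operatorname{Im}z>s\}$. Let $\phi_\mu(u)=F_\mu^{\langle-1\rangle}(u)-u$ denote the Voiculescu transform of $\mu$, where $F_\mu^{\langle -1\rangle}$ is the analytic right inverse of $F_\mu$ on a truncated cone $\{\operatorname{Im}u>\beta,\ |\operatorname{Re}u|<\alpha\operatorname{Im}u\}$, $\alpha,\beta>0$, with values in $\mathbb C^+$ and $F_\mu^{\langle-1\rangle}(u)/u\to1$ as $u\to\infty$ in the cone; $\mu\boxplus\nu=\rho$ means that $\phi_\rho=\phi_\mu+\phi_\nu$ on a common truncated cone. Let $\mu_1$ and $\mu_3$ be probability measures on $\mathbb R$ with finite variances $\sigma_1^2$ and $\sigma_3^2$ (finite second moments; $\sigma_1,\sigma_3\ge0$). Put $h_1(w)=w-F_{\mu_1}(w)$, $\tilde h_3(w)=F_{\mu_3}(w)+w$ and $T_z(w)=h_1(\tilde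 h_3(w)-z)+z$. For every $z\in\mathbb C_{2\sqrt2\sigma_1}$ and every $w$ with $\operatorname{Im}w>\frac34\operatorname{Im}z$ one has $\tilde h_3(w)-z\in\mathbb C^+$ and $\operatorname{Im}T_z(w)>\frac34\operatorname{Im}z$, so that $T_z$ is a well-defined self-map of $\mathbb C_{\frac34\operatorname{Im}z}$. There exist unique functions $\omega_1,\omega_3:\mathbb C_{2\sqrt2\sigma_1}\to\mathbb C^+$ with the following four properties, and these functions are analytic: 1. $\operatorname{Im}\omega_j(z)\ge\frac12\operatorname{Im}z$ for $z\in\mathbb C_{2\sqrt2\sigma_1}$, and $\lim_{y\to\infty}\frac{\omega_j(iy)}{iy}=1$, for $j=1,3$. 2. If $\mu_2$ is a probability measure on $\mathbb R$ with $\mu_1\boxplus\mu_2=\mu_3$, then $F_{\mu_2}(z)=F_{\mu_3}(\omega_3(z))=F_{\mu_1}(\omega_1(z))$ for $z\in\mathbb C_{2\sqrt2\sigma_1}$. 3. $\omega_1(z)-\omega_3(z)=F_{\mu_3}(\omega_3(z))-z$ for $z\in\mathbb C_{2\sqrt2\sigma_1}$. 4. For every $z\in\mathbb C_{2\sqrt2\sigma_1}$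 and every $w$ with $\operatorname{Im}w>\frac34\operatorname{Im}z$, the iterates $T_z^{\circ n}(w)$ converge to $\omega_3(z)$ as $n\to\infty$. Moreover $F_{\mu_3}(\omega_3(z))=F_{\mu_1}(\omega_1(z))$ on $\mathbb C_{2\sqrt2\sigma_1}$ whether or not such a $\mu_2$ exists, and $\omega_1,\omega_3$ are also the only functions on $\mathbb C_{2\sqrt2\sigma_1}$ that satisfy 1, 3 and this identity. -/

import Mathlib

open MeasureTheory ProbabilityTheory Filter Topology

/-- The Cauchy transform `G_μ(z) = ∫ 1 / (z - t) dμ(t)` (used for `Im z > 0`). -/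
noncomputable def cauchyG (μ : Measure ℝ) (z : ℂ) : ℂ :=
  ∫ t : ℝ, 1 / (z - (t : ℂ)) ∂μ

/-- The reciprocal Cauchy transform `F_μ = 1 / G_μ` (used for `Im z > 0`). -/
noncomputable def cauchyF (μ : Measure ℝ) (z : ℂ) : ℂ :=
  1 / cauchyG μ z

/-- The half-plane `ℂ_s = {z : Im z > s}`. -/
def halfPlane (s : ℝ) : Set ℂ := {z : ℂ | s < z.im}

/-- The truncated Stolz cone `Γ_{α,β} = {z : Im z > β, |Re z| < α Im z}`. -/
def truncCone (α β : ℝ) : Set ℂ := {z : ℂ | β < z.im ∧ |z.re| < α * z.im}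

/-- `K` is the inverse `F_μ^{<-1>}` of `F_μ` on the truncated cone `Γ_{α,β}`: the analytic right
inverse of `F_μ` with values in the upper half-plane and with `K(u) / u → 1` as `u → ∞` in the
cone. The Voiculescu transform is `φ_μ(u) = K u - u`; the condition at infinity is
`φ_μ(u) = o(u)`. -/
structure IsFInverse (μ : Measure ℝ) (α β : ℝ) (K : ℂ → ℂ) : Prop where
  analytic : AnalyticOnNhd ℂ K (truncCone α β)
  im_pos : ∀ u ∈ truncCone α β, 0 < (K u).im
  right_inv : ∀ u ∈ truncCone α β, cauchyF μ (K u) = u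
  tendsto_div : Tendsto (fun u : ℂ => K u / u)
    (Bornology.cobounded ℂ ⊓ 𝓟 (truncCone α β)) (𝓝 1)

/-- `μ ⊞ ν = ρ` (free additive convolution of probability measures on the line): the Voiculescu
transforms satisfy `φ_ρ = φ_μ + φ_ν` on a common truncated cone. -/
def IsFreeAddConv (μ ν ρ : Measure ℝ) : Prop :=
  ∃ α β : ℝ, 0 < α ∧ 0 < β ∧ ∃ Kμ Kν Kρ : ℂ → ℂ,
    IsFInverse μ α β Kμ ∧ IsFInverse ν α β Kν ∧ IsFInverse ρ α β Kρ ∧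
      ∀ u ∈ truncCone α β, Kρ u - u = (Kμ u - u) + (Kν u - u)

/-- `h_μ(w) = w - F_μ(w)`. -/
noncomputable def hTrans (μ : Measure ℝ) (w : ℂ) : ℂ := w - cauchyF μ w

/-- `h̃_μ(w) = F_μ(w) + w`. -/
noncomputable def hTilde (μ : Measure ℝ) (w : ℂ) : ℂ := cauchyF μ w + w

/-- `T_z(w) = h_{μ₁}(h̃_{μ₃}(w) - z) + z`. -/
noncomputable def deconvT (μ₁ μ₃ : Measure ℝ) (z w : ℂ) : ℂ :=
  hTrans μ₁ (hTilde μ₃ w - z) + z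

/-- The half-plane `ℂ_{2√2 σ}`, where `σ` is the standard deviation of `μ`. -/
noncomputable def deconvDomain (μ : Measure ℝ) : Set ℂ :=
  halfPlane (2 * √2 * √(Var[id; μ]))

/-- The normalization `Im ω(z) ≥ Im z / 2` on `D` and `ω(iy) / (iy) → 1` as `y → ∞`. -/
def SubordNormalized (D : Set ℂ) (ω : ℂ → ℂ) : Prop :=
  (∀ z ∈ D, z.im / 2 ≤ (ω z).im) ∧
    Tendsto (fun y : ℝ => ω (Complex.I * y) / (Complex.I * y)) atTop (𝓝 1)

/-- The four properties that characterize the subordination functions `ω₁, ω₃` of the free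
deconvolution of `μ₁` from `μ₃`; only the values on the half-plane `deconvDomain μ₁` matter. -/
structure IsDeconvPair (μ₁ μ₃ : Measure ℝ) (ω₁ ω₃ : ℂ → ℂ) : Prop where
  normalized₁ : SubordNormalized (deconvDomain μ₁) ω₁
  normalized₃ : SubordNormalized (deconvDomain μ₁) ω₃
  subord : ∀ μ₂ : Measure ℝ, IsProbabilityMeasure μ₂ → IsFreeAddConv μ₁ μ₂ μ₃ →
    ∀ z ∈ deconvDomain μ₁,
      cauchyF μ₂ z = cauchyF μ₃ (ω₃ z) ∧ cauchyF μ₃ (ω₃ z) = cauchyF μ₁ (ω₁ z)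
  diff : ∀ z ∈ deconvDomain μ₁, ω₁ z - ω₃ z = cauchyF μ₃ (ω₃ z) - z
  iterate : ∀ z ∈ deconvDomain μ₁, ∀ w ∈ halfPlane (3 * z.im / 4),
    Tendsto (fun n : ℕ => (deconvT μ₁ μ₃ z)^[n] w) atTop (𝓝 (ω₃ z))

/-!
For each `z` with `Im z > 2√2 σ₁`, the value `ω₃(z)` is the fixed point of `T_z`, and `ω₁(z) =
h̃₃(ω₃(z)) - z`. The fixed point comes from Banach's theorem: `T_z` is a contraction for the
Euclidean distance on the closed half-plane `Im w ≥ 3 Im z / 4`, so no hyperbolic geometry or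
Denjoy–Wolff theory is needed.

The estimates come from Cauchy–Schwarz applied to the resolvent `R_z(t) = 1 / (z - t)`. Since
`|R_z|² = -Im R_z / Im z`, the variance of `R_z` is `|G(z)|² (-Im h(z)) / Im z`
(`integral_norm_sq_resolvent_sub_cauchyG`), where `h = id - F`. The quantity `(h(z) - m) G(z)` is
the covariance of `t` and `R_z`, which gives `|h(z) - m| ≤ σ² / Im z`
(`norm_hTrans_sub_integral_le`). The difference quotient of `h` is a normalized covariance of two
resolvents, which gives `|h(z) - h(w)| ≤ σ² |z - w| / (Im z Im w)` (`norm_hTrans_sub_le`); in the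
same way `norm_hTilde_sub_le` bounds the difference quotient of `h̃`. Together they give the
Lipschitz constant `8 σ₁² / (Im z)²` for `T_z` (`norm_deconvT_sub_deconvT_le`).

Analyticity of `ω₃` follows since it is a locally uniform limit of the iterates of `T_z`
(`analyticOnNhd_of_deconvT_eq`). Subordination for `μ₁ ⊞ μ₂ = μ₃` holds along the curve `z =
K₂(iy)`, `y` large, where `K₃(iy)` is a fixed point of `T_z`, and extends by the identity theorem
(`cauchyF_eq_of_isFreeAddConv`). For uniqueness, any other pair produces a fixed point of `T_z` in
the half-plane where `T_z` contracts.
-/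

/-! ### Square-integrable complex functions -/

/-- The Cauchy–Schwarz inequality, without conjugation. -/
theorem norm_sq_integral_mul_le {Ω : Type*} [MeasurableSpace Ω] {μ : Measure Ω} {f g : Ω → ℂ}
    (hf : MemLp f 2 μ) (hg : MemLp g 2 μ) :
    ‖∫ x, f x * g x ∂μ‖ ^ 2 ≤ (∫ x, ‖f x‖ ^ 2 ∂μ) * ∫ x, ‖g x‖ ^ 2 ∂μ := by
  have h := integral_mul_norm_le_Lp_mul_Lq (μ := μ) (f := f) (g := g)
    Real.HolderConjugate.two_two (by simpa using hf) (by simpa using hg)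
  simp only [Real.rpow_two, ← Real.sqrt_eq_rpow] at h
  have h1 : ‖∫ x, f x * g x ∂μ‖ ≤ √(∫ x, ‖f x‖ ^ 2 ∂μ) * √(∫ x, ‖g x‖ ^ 2 ∂μ) := by
    refine (norm_integral_le_integral_norm _).trans ?_
    simpa only [norm_mul] using h
  calc ‖∫ x, f x * g x ∂μ‖ ^ 2
      ≤ (√(∫ x, ‖f x‖ ^ 2 ∂μ) * √(∫ x, ‖g x‖ ^ 2 ∂μ)) ^ 2 := by gcongr
    _ = _ := by
      rw [mul_pow, Real.sq_sqrt (by positivity), Real.sq_sqrt (by positivity)]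

/-- The variance of a complex random variable is `E|f|² - |E f|²`. -/
theorem integral_norm_sub_integral_sq {Ω : Type*} [MeasurableSpace Ω] {μ : Measure Ω}
    [IsProbabilityMeasure μ] {f : Ω → ℂ} (hf : MemLp f 2 μ) :
    ∫ x, ‖f x - ∫ y, f y ∂μ‖ ^ 2 ∂μ = ∫ x, ‖f x‖ ^ 2 ∂μ - ‖∫ x, f x ∂μ‖ ^ 2 := by
  set c := ∫ x, f x ∂μ with hc
  have hfi : Integrable f μ := hf.integrable (by norm_num)
  have hf2 : Integrable (fun x => ‖f x‖ ^ 2) μ := hf.integrable_norm_pow (by norm_num)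
  have hre : Integrable (fun x => 2 * ((f x) * starRingEnd ℂ c).re) μ :=
    ((hfi.mul_const _).re).const_mul 2
  have hint : ∫ x, ((f x) * starRingEnd ℂ c).re ∂μ = ‖c‖ ^ 2 := by
    have := integral_re (hfi.mul_const (starRingEnd ℂ c))
    simp only [RCLike.re_eq_complex_re] at this
    rw [this, integral_mul_const, ← hc, Complex.mul_conj, Complex.ofReal_re,
      Complex.normSq_eq_norm_sq]
  have hpt : ∀ x, ‖f x - c‖ ^ 2 = ‖f x‖ ^ 2 - 2 * ((f x) * starRingEnd ℂ c).re + ‖c‖ ^ 2 := by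
    intro x
    simp only [← Complex.normSq_eq_norm_sq, Complex.normSq_sub]; ring
  simp only [hpt]
  rw [integral_add (by exact hf2.sub hre) (integrable_const _), integral_sub hf2 hre,
    integral_const_mul, hint]
  simp; ring

/-! ### The Cauchy transform and the variance of the resolvent -/

theorem sub_ofReal_ne_zero {z : ℂ} (hz : 0 < z.im) (t : ℝ) : z - t ≠ 0 := by
  intro h
  have := congrArg Complex.im h
  simp at this
  exact hz.ne' this

theorem norm_one_div_sub_ofReal_le {z : ℂ} (hz : 0 < z.im) (t : ℝ) :
    ‖1 / (z - (t : ℂ))‖ ≤ 1 / z.im := by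
  rw [norm_div, norm_one]
  apply one_div_le_one_div_of_le hz
  have := Complex.abs_im_le_norm (z - t)
  simp only [Complex.sub_im, Complex.ofReal_im, sub_zero] at this
  exact (le_abs_self _).trans this

theorem continuous_one_div_sub_ofReal {z : ℂ} (hz : 0 < z.im) :
    Continuous fun t : ℝ => 1 / (z - (t : ℂ)) :=
  continuous_const.div (by fun_prop) (sub_ofReal_ne_zero hz)

theorem memLp_one_div_sub_ofReal (μ : Measure ℝ) [IsProbabilityMeasure μ] {z : ℂ} (hz : 0 < z.im)
    (p : ENNReal) : MemLp (fun t : ℝ => 1 / (z - (t : ℂ))) p μ :=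
  MemLp.of_bound (continuous_one_div_sub_ofReal hz).aestronglyMeasurable (1 / z.im)
    (.of_forall (norm_one_div_sub_ofReal_le hz))

theorem norm_sq_one_div_sub_ofReal {z : ℂ} (hz : 0 < z.im) (t : ℝ) :
    ‖1 / (z - (t : ℂ))‖ ^ 2 = -(1 / (z - (t : ℂ))).im / z.im := by
  have h := sub_ofReal_ne_zero hz t
  rw [one_div, Complex.inv_im, norm_inv, inv_pow, ← Complex.normSq_eq_norm_sq]
  have : Complex.normSq (z - t) ≠ 0 := by simpa using h
  simp
  field_simp

theorem integral_norm_sq_one_div_sub_ofReal (μ : Measure ℝ) [IsProbabilityMeasure μ] {z : ℂ}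
    (hz : 0 < z.im) :
    ∫ t : ℝ, ‖1 / (z - (t : ℂ))‖ ^ 2 ∂μ = -(cauchyG μ z).im / z.im := by
  have hi : Integrable (fun t : ℝ => 1 / (z - (t : ℂ))) μ :=
    (memLp_one_div_sub_ofReal μ hz 1).integrable le_rfl
  have := integral_im hi
  simp only [RCLike.im_eq_complex_im] at this
  simp only [norm_sq_one_div_sub_ofReal hz]
  rw [integral_div, integral_neg, this, cauchyG]

section
variable (μ : Measure ℝ) [IsProbabilityMeasure μ] {z w : ℂ}

theorem cauchyG_im_neg (hz : 0 < z.im) : (cauchyG μ z).im < 0 := by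
  have h := integral_norm_sq_one_div_sub_ofReal μ hz
  have hpos : 0 < ∫ t : ℝ, ‖1 / (z - (t : ℂ))‖ ^ 2 ∂μ := by
    rw [integral_pos_iff_support_of_nonneg (fun t => by positivity)
      ((memLp_one_div_sub_ofReal μ hz 2).integrable_norm_pow (by norm_num))]
    have : Function.support (fun t : ℝ => ‖1 / (z - (t : ℂ))‖ ^ 2) = Set.univ := by
      ext t; simp [sub_ofReal_ne_zero hz t]
    rw [this]; simp
  rw [h] at hpos
  have := (div_pos_iff_of_pos_right hz).1 hpos
  linarith

theorem cauchyG_ne_zero (hz : 0 < z.im) : cauchyG μ z ≠ 0 := fun h => by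
  simpa [h] using cauchyG_im_neg μ hz

theorem neg_cauchyG_im (hz : 0 < z.im) :
    -(cauchyG μ z).im = (cauchyF μ z).im * ‖cauchyG μ z‖ ^ 2 := by
  have h := cauchyG_ne_zero μ hz
  rw [cauchyF, one_div, Complex.inv_im, ← Complex.normSq_eq_norm_sq]
  have : Complex.normSq (cauchyG μ z) ≠ 0 := by simpa using h
  field_simp

theorem memLp_resolvent_sub_cauchyG (hz : 0 < z.im) :
    MemLp (fun t : ℝ => 1 / (z - (t : ℂ)) - cauchyG μ z) 2 μ :=
  (memLp_one_div_sub_ofReal μ hz 2).sub (memLp_const _)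

/-- The variance of the resolvent `R(t) = 1 / (z - t)` under `μ`, relative to `|E R|²`, is
`-Im h_μ(z) / Im z`. This turns every Cauchy–Schwarz estimate below into one in terms of
`Im h_μ` alone. -/
theorem integral_norm_sq_resolvent_sub_cauchyG (hz : 0 < z.im) :
    ∫ t : ℝ, ‖1 / (z - (t : ℂ)) - cauchyG μ z‖ ^ 2 ∂μ
      = ‖cauchyG μ z‖ ^ 2 * (-(hTrans μ z).im / z.im) := by
  have h := integral_norm_sub_integral_sq (memLp_one_div_sub_ofReal μ hz 2)
  rw [integral_norm_sq_one_div_sub_ofReal μ hz, neg_cauchyG_im μ hz] at h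
  change ∫ t : ℝ, ‖1 / (z - (t : ℂ)) - cauchyG μ z‖ ^ 2 ∂μ = _ - ‖cauchyG μ z‖ ^ 2 at h
  rw [h, hTrans, Complex.sub_im]
  field_simp
  ring

/-- `(h_μ(z) - m) G_μ(z)` is the covariance of `t` and the resolvent `1 / (z - t)`, where `m` is the
mean of `μ`. -/
theorem hTrans_sub_integral (hμ : MemLp id 2 μ) (hz : 0 < z.im) :
    (hTrans μ z - ↑(∫ t, t ∂μ)) * cauchyG μ z
      = ∫ t : ℝ, ((t - ∫ s, s ∂μ : ℝ) : ℂ) * (1 / (z - (t : ℂ)) - cauchyG μ z) ∂μ := by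
  -- Since `E[t - m] = 0`, subtracting `G` from the resolvent does not change the integral.
  set m := ∫ t, t ∂μ with hm
  set G := cauchyG μ z with hG
  have hG0 : G ≠ 0 := cauchyG_ne_zero μ hz
  have hid : Integrable (fun t : ℝ => t) μ := hμ.integrable (by norm_num)
  have hid' : Integrable (fun t : ℝ => ((t - m : ℝ) : ℂ)) μ :=
    (hid.sub (integrable_const m)).ofReal
  have hR : Integrable (fun t : ℝ => 1 / (z - (t : ℂ))) μ :=
    (memLp_one_div_sub_ofReal μ hz 1).integrable le_rfl
  have hpt : ∀ t : ℝ, ((t - m : ℝ) : ℂ) * (1 / (z - (t : ℂ)) - G)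
      = ((z - m) * (1 / (z - (t : ℂ))) - 1) - ((t - m : ℝ) : ℂ) * G := by
    intro t
    have := sub_ofReal_ne_zero hz t
    push_cast
    field_simp
    ring
  have h0 : ∫ t : ℝ, ((t - m : ℝ) : ℂ) ∂μ = 0 := by
    rw [integral_complex_ofReal, integral_sub hid (integrable_const m)]
    simp [← hm]
  simp only [hpt]
  rw [integral_sub (by exact (hR.const_mul _).sub (integrable_const _)) (hid'.mul_const _),
    integral_sub (hR.const_mul _) (integrable_const _), integral_const_mul, integral_mul_const, h0]
  change _ = (z - m) * G - _ - _
  simp only [hTrans, cauchyF, ← hG]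
  field_simp
  simp
  ring

/-- Cauchy–Schwarz for the covariance of `t` and the resolvent. As `-Im h_μ(z) ≤ |h_μ(z) - m|`, this
self-improves to `|h_μ(z) - m| ≤ σ² / Im z`; see `norm_hTrans_sub_integral_le`. -/
theorem norm_sq_hTrans_sub_integral_le (hμ : MemLp id 2 μ) (hz : 0 < z.im) :
    ‖hTrans μ z - ↑(∫ t, t ∂μ)‖ ^ 2 ≤ Var[id; μ] * (-(hTrans μ z).im / z.im) := by
  have hG0 : 0 < ‖cauchyG μ z‖ ^ 2 := by
    have := cauchyG_ne_zero μ hz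
    positivity
  have hc : MemLp (fun t : ℝ => ((t - ∫ s, s ∂μ : ℝ) : ℂ)) 2 μ :=
    (hμ.sub (memLp_const _)).ofReal
  have h := norm_sq_integral_mul_le hc (memLp_resolvent_sub_cauchyG μ hz)
  rw [← hTrans_sub_integral μ hμ hz, integral_norm_sq_resolvent_sub_cauchyG μ hz, norm_mul,
    mul_pow] at h
  have hv : Var[id; μ] = ∫ t : ℝ, ‖((t - ∫ s, s ∂μ : ℝ) : ℂ)‖ ^ 2 ∂μ := by
    rw [variance_eq_integral aemeasurable_id]
    simp only [Complex.norm_real, Real.norm_eq_abs, sq_abs, id]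
  rw [← hv] at h
  refine le_of_mul_le_mul_right ?_ hG0
  linarith

/-- `F_μ` does not decrease imaginary parts, because the resolvent has nonnegative variance. -/
theorem im_le_cauchyF_im (hz : 0 < z.im) : z.im ≤ (cauchyF μ z).im := by
  have hG0 : 0 < ‖cauchyG μ z‖ ^ 2 := by
    have := cauchyG_ne_zero μ hz
    positivity
  have h : 0 ≤ ‖cauchyG μ z‖ ^ 2 * (-(hTrans μ z).im / z.im) := by
    rw [← integral_norm_sq_resolvent_sub_cauchyG μ hz]
    positivity
  have h1 := mul_nonneg (nonneg_of_mul_nonneg_right h hG0) hz.le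
  rw [div_mul_cancel₀ _ hz.ne'] at h1
  simp only [hTrans, Complex.sub_im] at h1
  linarith

theorem norm_hTrans_sub_integral_le (hμ : MemLp id 2 μ) (hz : 0 < z.im) :
    ‖hTrans μ z - ↑(∫ t, t ∂μ)‖ ≤ Var[id; μ] / z.im := by
  have h := norm_sq_hTrans_sub_integral_le μ hμ hz
  have h1 := Complex.abs_im_le_norm (hTrans μ z - ↑(∫ t, t ∂μ))
  simp only [Complex.sub_im, Complex.ofReal_im, sub_zero] at h1
  have hv : 0 ≤ Var[id; μ] := variance_nonneg _ _
  rcases (norm_nonneg (hTrans μ z - ↑(∫ t, t ∂μ))).eq_or_lt with h0 | h0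
  · rw [← h0]; positivity
  · refine le_of_mul_le_mul_right ?_ h0
    rw [← sq]
    refine h.trans ?_
    rw [div_mul_eq_mul_div, ← mul_div_assoc]
    gcongr
    exact (neg_le_abs _).trans h1

theorem neg_hTrans_im_le (hμ : MemLp id 2 μ) (hz : 0 < z.im) :
    -(hTrans μ z).im ≤ Var[id; μ] / z.im := by
  have h1 := Complex.abs_im_le_norm (hTrans μ z - ↑(∫ t, t ∂μ))
  simp only [Complex.sub_im, Complex.ofReal_im, sub_zero] at h1
  exact ((neg_le_abs _).trans h1).trans (norm_hTrans_sub_integral_le μ hμ hz)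

/-! ### Two-point estimates -/

theorem cauchyF_sub (hz : 0 < z.im) (hw : 0 < w.im) :
    (cauchyF μ z - cauchyF μ w) * (cauchyG μ z * cauchyG μ w)
      = (z - w) * ∫ t : ℝ, 1 / (z - (t : ℂ)) * (1 / (w - (t : ℂ))) ∂μ := by
  have hGz := cauchyG_ne_zero μ hz
  have hGw := cauchyG_ne_zero μ hw
  have h : (cauchyF μ z - cauchyF μ w) * (cauchyG μ z * cauchyG μ w)
      = cauchyG μ w - cauchyG μ z := by
    simp only [cauchyF]; field_simp
  rw [h, cauchyG, cauchyG, ← integral_sub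
    ((memLp_one_div_sub_ofReal μ hw 1).integrable le_rfl)
    ((memLp_one_div_sub_ofReal μ hz 1).integrable le_rfl), ← integral_const_mul]
  congr 1 with t
  have := sub_ofReal_ne_zero hz t
  have := sub_ofReal_ne_zero hw t
  field_simp
  ring

/-- The difference quotient of `h_μ` is, up to the factor `G_μ(z) G_μ(w)`, minus the covariance of
the two resolvents. -/
theorem hTrans_sub (hz : 0 < z.im) (hw : 0 < w.im) :
    (hTrans μ z - hTrans μ w) * (cauchyG μ z * cauchyG μ w)
      = -(z - w) * ∫ t : ℝ, (1 / (z - (t : ℂ)) - cauchyG μ z) *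
          (1 / (w - (t : ℂ)) - cauchyG μ w) ∂μ := by
  have h := cauchyF_sub μ hz hw
  have hRz := memLp_one_div_sub_ofReal μ hz 2
  have hRw := memLp_one_div_sub_ofReal μ hw 2
  have hz1 := hRz.integrable (by norm_num)
  have hw1 := hRw.integrable (by norm_num)
  have hcov : ∫ t : ℝ, (1 / (z - (t : ℂ)) - cauchyG μ z) * (1 / (w - (t : ℂ)) - cauchyG μ w) ∂μ
      = ∫ t : ℝ, 1 / (z - (t : ℂ)) * (1 / (w - (t : ℂ))) ∂μ - cauchyG μ z * cauchyG μ w := by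
    have hpt : ∀ t : ℝ, (1 / (z - (t : ℂ)) - cauchyG μ z) * (1 / (w - (t : ℂ)) - cauchyG μ w)
      = 1 / (z - (t : ℂ)) * (1 / (w - (t : ℂ))) - cauchyG μ z * (1 / (w - (t : ℂ)) - cauchyG μ w)
        - 1 / (z - (t : ℂ)) * cauchyG μ w := fun t => by ring
    simp only [hpt]
    have hi1 : Integrable (fun t : ℝ => 1 / (z - (t : ℂ)) * (1 / (w - (t : ℂ)))) μ :=
      hRz.integrable_mul hRw
    have hi2 : Integrable (fun t : ℝ => cauchyG μ z * (1 / (w - (t : ℂ)) - cauchyG μ w)) μ :=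
      (hw1.sub (integrable_const _)).const_mul _
    rw [integral_sub (by exact hi1.sub hi2) (hz1.mul_const _), integral_sub hi1 hi2,
      integral_const_mul, integral_mul_const, integral_sub hw1 (integrable_const _)]
    simp only [← cauchyG.eq_1]
    simp
  rw [hcov]
  simp only [hTrans]
  linear_combination -h

theorem norm_sq_cauchyF_sub_le (hz : 0 < z.im) (hw : 0 < w.im) :
    ‖cauchyF μ z - cauchyF μ w‖ ^ 2
      ≤ (cauchyF μ z).im / z.im * ((cauchyF μ w).im / w.im) * ‖z - w‖ ^ 2 := by
  have hG0 : 0 < ‖cauchyG μ z‖ ^ 2 * ‖cauchyG μ w‖ ^ 2 := by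
    have := cauchyG_ne_zero μ hz
    have := cauchyG_ne_zero μ hw
    positivity
  have h := norm_sq_integral_mul_le (memLp_one_div_sub_ofReal μ hz 2)
    (memLp_one_div_sub_ofReal μ hw 2)
  rw [integral_norm_sq_one_div_sub_ofReal μ hz, integral_norm_sq_one_div_sub_ofReal μ hw,
    neg_cauchyG_im μ hz, neg_cauchyG_im μ hw] at h
  have h2 := congrArg (‖·‖ ^ 2) (cauchyF_sub μ hz hw)
  simp only [norm_mul, mul_pow] at h2
  refine le_of_mul_le_mul_right ?_ hG0
  rw [h2]
  refine (mul_le_mul_of_nonneg_left h (by positivity)).trans (le_of_eq ?_)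
  ring

theorem norm_hTrans_sub_le (hμ : MemLp id 2 μ) (hz : 0 < z.im) (hw : 0 < w.im) :
    ‖hTrans μ z - hTrans μ w‖ ≤ Var[id; μ] / (z.im * w.im) * ‖z - w‖ := by
  have hG0 : 0 < ‖cauchyG μ z‖ ^ 2 * ‖cauchyG μ w‖ ^ 2 := by
    have := cauchyG_ne_zero μ hz
    have := cauchyG_ne_zero μ hw
    positivity
  have hv : 0 ≤ Var[id; μ] := variance_nonneg _ _
  have h := norm_sq_integral_mul_le (memLp_resolvent_sub_cauchyG μ hz)
    (memLp_resolvent_sub_cauchyG μ hw)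
  rw [integral_norm_sq_resolvent_sub_cauchyG μ hz, integral_norm_sq_resolvent_sub_cauchyG μ hw] at h
  have h2 := congrArg (‖·‖ ^ 2) (hTrans_sub μ hz hw)
  simp only [norm_mul, norm_neg, mul_pow] at h2
  have hz1 : -(hTrans μ z).im / z.im ≤ Var[id; μ] / z.im / z.im := by
    gcongr; exact neg_hTrans_im_le μ hμ hz
  have hw1 : -(hTrans μ w).im / w.im ≤ Var[id; μ] / w.im / w.im := by
    gcongr; exact neg_hTrans_im_le μ hμ hw
  have hw0 : 0 ≤ -(hTrans μ w).im / w.im := by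
    have := im_le_cauchyF_im μ hw
    apply div_nonneg _ hw.le
    simp only [hTrans, Complex.sub_im]
    linarith
  refine (sq_le_sq₀ (norm_nonneg _) (by positivity)).1 ?_
  refine le_of_mul_le_mul_right ?_ hG0
  rw [h2]
  calc ‖z - w‖ ^ 2 * _ ≤ ‖z - w‖ ^ 2 * _ := mul_le_mul_of_nonneg_left h (by positivity)
    _ = (-(hTrans μ z).im / z.im * (-(hTrans μ w).im / w.im)) *
        (‖z - w‖ ^ 2 * (‖cauchyG μ z‖ ^ 2 * ‖cauchyG μ w‖ ^ 2)) := by ring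
    _ ≤ (Var[id; μ] / z.im / z.im * (Var[id; μ] / w.im / w.im)) *
        (‖z - w‖ ^ 2 * (‖cauchyG μ z‖ ^ 2 * ‖cauchyG μ w‖ ^ 2)) := by
        gcongr
    _ = _ := by field_simp

theorem hTilde_im_ge (hz : 0 < z.im) : 2 * z.im ≤ (hTilde μ z).im := by
  have := im_le_cauchyF_im μ hz
  simp only [hTilde, Complex.add_im]
  linarith

theorem norm_hTilde_sub_le (hz : 0 < z.im) (hw : 0 < w.im) :
    ‖hTilde μ z - hTilde μ w‖
      ≤ √((hTilde μ z).im / z.im) * √((hTilde μ w).im / w.im) * ‖z - w‖ := by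
  have hFz := im_le_cauchyF_im μ hz
  have hFw := im_le_cauchyF_im μ hw
  have hp : 0 ≤ (cauchyF μ z).im / z.im := div_nonneg (by linarith) hz.le
  have hq : 0 ≤ (cauchyF μ w).im / w.im := div_nonneg (by linarith) hw.le
  have e : ∀ v : ℂ, 0 < v.im → (hTilde μ v).im / v.im = (cauchyF μ v).im / v.im + 1 := by
    intro v hv
    simp only [hTilde, Complex.add_im]
    field_simp
  rw [e z hz, e w hw]
  set p := (cauchyF μ z).im / z.im with hp'
  set q := (cauchyF μ w).im / w.im with hq'
  have h1 : ‖cauchyF μ z - cauchyF μ w‖ ≤ √(p * q) * ‖z - w‖ := by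
    refine (sq_le_sq₀ (norm_nonneg _) (by positivity)).1 ?_
    rw [mul_pow, Real.sq_sqrt (by positivity)]
    exact norm_sq_cauchyF_sub_le μ hz hw
  -- Cauchy–Schwarz in `ℝ²` for `(√p, 1)` and `(√q, 1)`.
  have h2 : √(p * q) + 1 ≤ √(p + 1) * √(q + 1) := by
    rw [← Real.sqrt_mul (by positivity)]
    apply Real.le_sqrt_of_sq_le
    have hs := Real.sq_sqrt (mul_nonneg hp hq)
    have : 2 * √(p * q) ≤ p + q := by
      rw [Real.sqrt_mul hp]
      nlinarith [sq_nonneg (√p - √q), Real.sq_sqrt hp, Real.sq_sqrt hq]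
    nlinarith
  calc ‖hTilde μ z - hTilde μ w‖ = ‖(cauchyF μ z - cauchyF μ w) + (z - w)‖ := by
        simp only [hTilde]; congr 1; ring
    _ ≤ √(p * q) * ‖z - w‖ + ‖z - w‖ := (norm_add_le _ _).trans (by gcongr)
    _ = (√(p * q) + 1) * ‖z - w‖ := by ring
    _ ≤ _ := by gcongr

/-! ### Holomorphy -/

theorem isOpen_halfPlane (s : ℝ) : IsOpen (halfPlane s) :=
  isOpen_lt continuous_const Complex.continuous_im

theorem differentiableAt_cauchyG (hz : 0 < z.im) : DifferentiableAt ℂ (cauchyG μ) z := by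
  have hs : halfPlane (z.im / 2) ∈ 𝓝 z :=
    (isOpen_halfPlane _).mem_nhds (by simp only [halfPlane, Set.mem_ofPred_eq]; linarith)
  have hpos : ∀ x ∈ halfPlane (z.im / 2), z.im / 2 < x.im := fun x hx => hx
  refine (hasDerivAt_integral_of_dominated_loc_of_deriv_le (μ := μ) (s := halfPlane (z.im / 2))
    (F := fun x (t : ℝ) => 1 / (x - (t : ℂ)))
    (F' := fun x (t : ℝ) => -(1 / (x - (t : ℂ))) ^ 2) (bound := fun _ => (1 / (z.im / 2)) ^ 2)
    hs ?_ ((memLp_one_div_sub_ofReal μ hz 1).integrable le_rfl) ?_ ?_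
    (integrable_const _) ?_).2.differentiableAt
  · filter_upwards [hs] with x hx
    exact (continuous_one_div_sub_ofReal (by linarith [hpos x hx])).aestronglyMeasurable
  · exact ((continuous_one_div_sub_ofReal hz).pow 2).neg.aestronglyMeasurable
  · refine .of_forall fun t x hx => ?_
    have hx' := hpos x hx
    rw [norm_neg, norm_pow]
    gcongr
    exact (norm_one_div_sub_ofReal_le (by linarith) t).trans (by gcongr)
  · refine .of_forall fun t x hx => ?_
    have hx' := hpos x hx
    have h0 : x - t ≠ 0 := sub_ofReal_ne_zero (by linarith) t
    have := ((hasDerivAt_id x).sub_const (t : ℂ)).fun_inv h0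
    simp only [id] at this
    simp only [one_div]
    have e : -((x - (t : ℂ))⁻¹) ^ 2 = -1 / (x - (t : ℂ)) ^ 2 := by rw [inv_pow, neg_div, one_div]
    rw [e]
    exact this

theorem differentiableAt_cauchyF (hz : 0 < z.im) : DifferentiableAt ℂ (cauchyF μ) z :=
  (differentiableAt_const 1).div (differentiableAt_cauchyG μ hz) (cauchyG_ne_zero μ hz)

theorem differentiableAt_hTrans (hz : 0 < z.im) : DifferentiableAt ℂ (hTrans μ) z :=
  differentiableAt_id.sub (differentiableAt_cauchyF μ hz)

theorem differentiableAt_hTilde (hz : 0 < z.im) : DifferentiableAt ℂ (hTilde μ) z :=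
  (differentiableAt_cauchyF μ hz).add differentiableAt_id

end

/-! ### The map `T_z` and its fixed point -/

theorem im_pos_of_mem_deconvDomain {μ : Measure ℝ} {z : ℂ} (hz : z ∈ deconvDomain μ) :
    0 < z.im :=
  lt_of_le_of_lt (by positivity) (show 2 * √2 * √(Var[id; μ]) < z.im from hz)

theorem eight_mul_variance_lt {μ : Measure ℝ} {z : ℂ} (hz : z ∈ deconvDomain μ) :
    8 * Var[id; μ] < z.im ^ 2 := by
  have h : 2 * √2 * √(Var[id; μ]) < z.im := hz
  have h2 := pow_lt_pow_left₀ h (by positivity) two_ne_zero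
  rw [mul_pow, mul_pow, Real.sq_sqrt (by norm_num), Real.sq_sqrt (variance_nonneg _ _)] at h2
  linarith

section
variable (μ₁ μ₃ : Measure ℝ) {z w : ℂ}

theorem deconvRatio_lt_one (hz : z ∈ deconvDomain μ₁) : 8 * Var[id; μ₁] / z.im ^ 2 < 1 := by
  have := im_pos_of_mem_deconvDomain hz
  rw [div_lt_one (by positivity)]
  exact eight_mul_variance_lt hz

theorem isOpen_deconvDomain : IsOpen (deconvDomain μ₁) := isOpen_halfPlane _

theorem I_mul_mem_deconvDomain_eventually :
    ∀ᶠ y : ℝ in atTop, Complex.I * y ∈ deconvDomain μ₁ := by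
  filter_upwards [eventually_gt_atTop (2 * √2 * √(Var[id; μ₁]))] with y hy
  show 2 * √2 * √(Var[id; μ₁]) < (Complex.I * y).im
  simpa using hy

theorem tendsto_div_I_mul_of_norm_sub_le {f : ℂ → ℂ} {C : ℝ}
    (h : ∀ᶠ y : ℝ in atTop, ‖f (Complex.I * y) - Complex.I * y‖ ≤ C) :
    Tendsto (fun y : ℝ => f (Complex.I * y) / (Complex.I * y)) atTop (𝓝 1) := by
  rw [tendsto_iff_norm_sub_tendsto_zero]
  refine squeeze_zero' (.of_forall fun _ => norm_nonneg _) ?_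
    (tendsto_const_nhds.div_atTop tendsto_id : Tendsto (fun y : ℝ => C / y) atTop (𝓝 0))
  filter_upwards [h, eventually_gt_atTop 0] with y hy hy0
  have hne : Complex.I * y ≠ 0 := by simp [hy0.ne']
  rw [div_sub_one hne, norm_div]
  simp only [norm_mul, Complex.norm_I, one_mul, Complex.norm_real, Real.norm_eq_abs,
    abs_of_pos hy0]
  gcongr

/-- The two equations for a pair of subordination functions at `z` say that the value `w` of the
second one is a fixed point of `T_z`. -/
theorem deconvT_eq_of_cauchyF_eq {w' : ℂ} (h1 : w' - w = cauchyF μ₃ w - z)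
    (h2 : cauchyF μ₃ w = cauchyF μ₁ w') : hTilde μ₃ w - z = w' ∧ deconvT μ₁ μ₃ z w = w := by
  have e : hTilde μ₃ w - z = w' := by simp only [hTilde]; linear_combination -h1
  refine ⟨e, ?_⟩
  rw [deconvT, e, hTrans]
  linear_combination h1 + h2

theorem cauchyF_eq_of_deconvT_eq (h : deconvT μ₁ μ₃ z w = w) :
    cauchyF μ₃ w = cauchyF μ₁ (hTilde μ₃ w - z) := by
  rw [deconvT, hTrans] at h
  have : hTilde μ₃ w = cauchyF μ₃ w + w := rfl
  linear_combination h - this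

variable [IsProbabilityMeasure μ₁] [IsProbabilityMeasure μ₃]

theorem half_im_le_hTilde_sub_im (hz : 0 < z.im) (hw : 3 * z.im / 4 ≤ w.im) :
    z.im / 2 ≤ (hTilde μ₃ w - z).im := by
  have := hTilde_im_ge μ₃ (z := w) (by linarith)
  simp only [Complex.sub_im]
  linarith

theorem lt_hTrans_add_im (hμ₁ : MemLp id 2 μ₁) (hz : z ∈ deconvDomain μ₁)
    (hw : z.im / 2 ≤ w.im) : 3 * z.im / 4 < (hTrans μ₁ w + z).im := by
  have h0 := im_pos_of_mem_deconvDomain hz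
  have h1 := neg_hTrans_im_le μ₁ hμ₁ (z := w) (by linarith)
  have hv : 0 ≤ Var[id; μ₁] := variance_nonneg _ _
  have h2 : Var[id; μ₁] / w.im ≤ Var[id; μ₁] / (z.im / 2) := by gcongr
  have h3 : Var[id; μ₁] / (z.im / 2) < z.im / 4 := by
    rw [div_lt_iff₀ (by linarith)]
    linarith [eight_mul_variance_lt hz]
  simp only [Complex.add_im]
  linarith

theorem lt_deconvT_im (hμ₁ : MemLp id 2 μ₁) (hz : z ∈ deconvDomain μ₁)
    (hw : 3 * z.im / 4 ≤ w.im) : 3 * z.im / 4 < (deconvT μ₁ μ₃ z w).im :=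
  lt_hTrans_add_im μ₁ hμ₁ hz
    (half_im_le_hTilde_sub_im μ₃ (im_pos_of_mem_deconvDomain hz) hw)

theorem norm_deconvT_sub_le (hμ₁ : MemLp id 2 μ₁) (hz : 0 < z.im) (hw : 3 * z.im / 4 ≤ w.im) :
    ‖deconvT μ₁ μ₃ z w - z - ↑(∫ t, t ∂μ₁)‖ ≤ Var[id; μ₁] / (z.im / 2) := by
  have h := half_im_le_hTilde_sub_im μ₃ hz hw
  have hv : 0 ≤ Var[id; μ₁] := variance_nonneg _ _
  rw [deconvT, add_sub_cancel_right]
  refine (norm_hTrans_sub_integral_le μ₁ hμ₁ (by linarith)).trans ?_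
  gcongr

/-- The numerical heart of the contraction estimate: with `s = Im h̃_μ(w)`, `b = Im w`, `y = Im
z`, the inequality `s / b ≤ 8 (s - y)² / y²` holds when `b ≥ 3 y / 4` and `s ≥ 2 b`, with equality
when both bounds are attained. This is where the constants `3 / 4` and `2√2` come from. -/
theorem sqrt_hTilde_im_div_le (hz : 0 < z.im) (hw : 3 * z.im / 4 ≤ w.im) :
    √((hTilde μ₃ w).im / w.im) ≤ √8 / z.im * (hTilde μ₃ w - z).im := by
  have hw0 : 0 < w.im := by linarith
  have hv := half_im_le_hTilde_sub_im μ₃ hz hw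
  have hs := hTilde_im_ge μ₃ hw0
  simp only [Complex.sub_im] at hv ⊢
  set s := (hTilde μ₃ w).im
  apply Real.sqrt_le_iff.2
  constructor
  · have : 0 ≤ s - z.im := by linarith
    positivity
  rw [mul_pow, div_pow, Real.sq_sqrt (by norm_num), div_mul_eq_mul_div]
  calc s / w.im ≤ s / (3 * z.im / 4) := by gcongr; linarith
    _ ≤ _ := by
      rw [div_le_div_iff₀ (by positivity) (by positivity)]
      have : s * z.im ≤ 6 * (s - z.im) ^ 2 := by
        nlinarith [mul_nonneg hz.le (show 0 ≤ s - 3 * z.im / 2 by linarith),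
          sq_nonneg (s - 3 * z.im / 2)]
      nlinarith

/-- `T_z` is Lipschitz for the Euclidean distance on `Im w ≥ 3 Im z / 4`, with a constant that is
less than `1` exactly when `Im z > 2√2 σ₁`. -/
theorem norm_deconvT_sub_deconvT_le (hμ₁ : MemLp id 2 μ₁) {w' : ℂ} (hz : 0 < z.im)
    (hw : 3 * z.im / 4 ≤ w.im) (hw' : 3 * z.im / 4 ≤ w'.im) :
    ‖deconvT μ₁ μ₃ z w - deconvT μ₁ μ₃ z w'‖ ≤ 8 * Var[id; μ₁] / z.im ^ 2 * ‖w - w'‖ := by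
  have hv := half_im_le_hTilde_sub_im μ₃ hz hw
  have hv' := half_im_le_hTilde_sub_im μ₃ hz hw'
  have hs := sqrt_hTilde_im_div_le μ₃ hz hw
  have hs' := sqrt_hTilde_im_div_le μ₃ hz hw'
  have hH := norm_hTilde_sub_le μ₃ (z := w) (w := w') (by linarith) (by linarith)
  have hV : 0 ≤ Var[id; μ₁] := variance_nonneg _ _
  have h := norm_hTrans_sub_le μ₁ hμ₁ (z := hTilde μ₃ w - z) (w := hTilde μ₃ w' - z)
    (by linarith) (by linarith)
  rw [sub_sub_sub_cancel_right] at h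
  set a := (hTilde μ₃ w - z).im
  set b := (hTilde μ₃ w' - z).im
  have ha : 0 < a := by linarith
  have hb : 0 < b := by linarith
  calc ‖deconvT μ₁ μ₃ z w - deconvT μ₁ μ₃ z w'‖
      ≤ Var[id; μ₁] / (a * b) * ‖hTilde μ₃ w - hTilde μ₃ w'‖ := by
        simpa only [deconvT, add_sub_add_right_eq_sub] using h
    _ ≤ Var[id; μ₁] / (a * b) * ((√8 / z.im * a) * (√8 / z.im * b) * ‖w - w'‖) := by
        refine mul_le_mul_of_nonneg_left (hH.trans ?_) (by positivity)
        gcongr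
    _ = √8 ^ 2 * Var[id; μ₁] / z.im ^ 2 * ‖w - w'‖ := by field_simp
    _ = _ := by rw [Real.sq_sqrt (by norm_num)]

theorem eq_of_deconvT_eq (hμ₁ : MemLp id 2 μ₁) {w' : ℂ} (hz : z ∈ deconvDomain μ₁)
    (hw : 3 * z.im / 4 ≤ w.im) (hw' : 3 * z.im / 4 ≤ w'.im)
    (h : deconvT μ₁ μ₃ z w = w) (h' : deconvT μ₁ μ₃ z w' = w') : w = w' := by
  have h1 := norm_deconvT_sub_deconvT_le μ₁ μ₃ hμ₁ (im_pos_of_mem_deconvDomain hz) hw hw'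
  rw [h, h'] at h1
  have h2 := deconvRatio_lt_one μ₁ hz
  by_contra hne
  have : 0 < ‖w - w'‖ := norm_pos_iff.2 (sub_ne_zero.2 hne)
  nlinarith

theorem exists_deconvT_eq (hμ₁ : MemLp id 2 μ₁) (hz : z ∈ deconvDomain μ₁) :
    ∃ w : ℂ, 3 * z.im / 4 ≤ w.im ∧ deconvT μ₁ μ₃ z w = w := by
  have h0 := im_pos_of_mem_deconvDomain hz
  have hV : 0 ≤ Var[id; μ₁] := variance_nonneg _ _
  set s : Set ℂ := {w | 3 * z.im / 4 ≤ w.im} with hs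
  have hsc : IsComplete s := (isClosed_le continuous_const Complex.continuous_im).isComplete
  have hsf : Set.MapsTo (deconvT μ₁ μ₃ z) s s := fun w hw => (lt_deconvT_im μ₁ μ₃ hμ₁ hz hw).le
  have hc : ContractingWith (8 * Var[id; μ₁] / z.im ^ 2).toNNReal (hsf.restrict _ s s) := by
    refine ⟨by simpa using deconvRatio_lt_one μ₁ hz, LipschitzWith.of_dist_le_mul fun x y => ?_⟩
    rw [Real.coe_toNNReal _ (by positivity), Subtype.dist_eq, Subtype.dist_eq, dist_eq_norm,
      dist_eq_norm]
    exact norm_deconvT_sub_deconvT_le μ₁ μ₃ hμ₁ h0 x.2 y.2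
  obtain ⟨w, hw, hfix, -⟩ := hc.exists_fixedPoint' hsc hsf (x := z)
    (show 3 * z.im / 4 ≤ z.im by linarith) (edist_ne_top _ _)
  exact ⟨w, hw, hfix⟩

theorem le_deconvT_iterate_im (hμ₁ : MemLp id 2 μ₁) (hz : z ∈ deconvDomain μ₁)
    (hw : 3 * z.im / 4 ≤ w.im) (n : ℕ) : 3 * z.im / 4 ≤ ((deconvT μ₁ μ₃ z)^[n] w).im := by
  cases n with
  | zero => exact hw
  | succ n =>
    rw [Function.iterate_succ_apply']
    exact (lt_deconvT_im μ₁ μ₃ hμ₁ hz (le_deconvT_iterate_im hμ₁ hz hw n)).le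

theorem norm_deconvT_iterate_sub_le (hμ₁ : MemLp id 2 μ₁) {x : ℂ} (hz : z ∈ deconvDomain μ₁)
    (hw : 3 * z.im / 4 ≤ w.im) (hx : 3 * z.im / 4 ≤ x.im) (hfix : deconvT μ₁ μ₃ z x = x) (n : ℕ) :
    ‖(deconvT μ₁ μ₃ z)^[n] w - x‖ ≤ (8 * Var[id; μ₁] / z.im ^ 2) ^ n * ‖w - x‖ := by
  have hV : 0 ≤ Var[id; μ₁] := variance_nonneg _ _
  induction n with
  | zero => simp
  | succ n ih =>
    rw [Function.iterate_succ_apply', pow_succ']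
    nth_rewrite 1 [← hfix]
    refine (norm_deconvT_sub_deconvT_le μ₁ μ₃ hμ₁ (im_pos_of_mem_deconvDomain hz)
      (le_deconvT_iterate_im μ₁ μ₃ hμ₁ hz hw n) hx).trans ?_
    rw [mul_assoc]
    gcongr

theorem tendsto_deconvT_iterate (hμ₁ : MemLp id 2 μ₁) {x : ℂ} (hz : z ∈ deconvDomain μ₁)
    (hw : 3 * z.im / 4 ≤ w.im) (hx : 3 * z.im / 4 ≤ x.im) (hfix : deconvT μ₁ μ₃ z x = x) :
    Tendsto (fun n : ℕ => (deconvT μ₁ μ₃ z)^[n] w) atTop (𝓝 x) := by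
  have hV : 0 ≤ Var[id; μ₁] := variance_nonneg _ _
  rw [tendsto_iff_norm_sub_tendsto_zero]
  refine squeeze_zero (fun _ => norm_nonneg _)
    (norm_deconvT_iterate_sub_le μ₁ μ₃ hμ₁ hz hw hx hfix) ?_
  simpa using (tendsto_pow_atTop_nhds_zero_of_lt_one (by positivity)
    (deconvRatio_lt_one μ₁ hz)).mul_const ‖w - x‖

theorem norm_sub_le_of_deconvT_eq (hμ₁ : MemLp id 2 μ₁) (hz : 0 < z.im)
    (hw : 3 * z.im / 4 ≤ w.im) (hfix : deconvT μ₁ μ₃ z w = w) :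
    ‖w - z‖ ≤ Var[id; μ₁] / (z.im / 2) + ‖((∫ t, t ∂μ₁ : ℝ) : ℂ)‖ := by
  have hb := norm_deconvT_sub_le μ₁ μ₃ hμ₁ hz hw
  rw [hfix] at hb
  calc ‖w - z‖ = ‖(w - z - ↑(∫ t, t ∂μ₁)) + ↑(∫ t, t ∂μ₁)‖ := by congr 1; ring
    _ ≤ _ := (norm_add_le _ _).trans (by gcongr)

theorem differentiableOn_deconvT_iterate (hμ₁ : MemLp id 2 μ₁) (n : ℕ) :
    DifferentiableOn ℂ (fun z => (deconvT μ₁ μ₃ z)^[n] z) (deconvDomain μ₁) := by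
  induction n with
  | zero => exact differentiableOn_id
  | succ n ih =>
    intro z hz
    have h0 := im_pos_of_mem_deconvDomain hz
    have h1 := le_deconvT_iterate_im μ₁ μ₃ hμ₁ hz (w := z) (by linarith) n
    have h2 := half_im_le_hTilde_sub_im μ₃ h0 h1
    simp only [Function.iterate_succ_apply', deconvT]
    have hd : DifferentiableWithinAt ℂ (fun z => hTilde μ₃ ((deconvT μ₁ μ₃ z)^[n] z) - z)
        (deconvDomain μ₁) z :=
      ((differentiableAt_hTilde μ₃ (by linarith)).comp_differentiableWithinAt z (ih z hz)).sub
        differentiableWithinAt_id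
    exact (DifferentiableAt.comp_differentiableWithinAt
      (f := fun z => hTilde μ₃ ((deconvT μ₁ μ₃ z)^[n] z) - z) z
      (differentiableAt_hTrans μ₁ ((half_pos h0).trans_le h2)) hd).add differentiableWithinAt_id

/-- The fixed point of `T_z` depends analytically on `z`: on each half-plane inside the domain it is
the uniform limit of the iterates `T_z^n(z)`. -/
theorem analyticOnNhd_of_deconvT_eq (hμ₁ : MemLp id 2 μ₁) {ω : ℂ → ℂ}
    (him : ∀ z ∈ deconvDomain μ₁, 3 * z.im / 4 ≤ (ω z).im)
    (hfix : ∀ z ∈ deconvDomain μ₁, deconvT μ₁ μ₃ z (ω z) = ω z) :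
    AnalyticOnNhd ℂ ω (deconvDomain μ₁) := by
  intro z₀ hz₀
  have hV : 0 ≤ Var[id; μ₁] := variance_nonneg _ _
  obtain ⟨s, hs1, hs2⟩ := exists_between (show 2 * √2 * √(Var[id; μ₁]) < z₀.im from hz₀)
  have hsub : halfPlane s ⊆ deconvDomain μ₁ := fun z (hz : s < z.im) => hs1.trans hz
  -- The contraction constant at height `s` bounds those at all larger heights.
  have hsI : (s * Complex.I : ℂ) ∈ deconvDomain μ₁ :=
    show 2 * √2 * √(Var[id; μ₁]) < (s * Complex.I : ℂ).im by simpa using hs1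
  have hs0 : 0 < s := by simpa using im_pos_of_mem_deconvDomain hsI
  have hq : 8 * Var[id; μ₁] / s ^ 2 < 1 := by simpa using deconvRatio_lt_one μ₁ hsI
  have hunif : TendstoUniformlyOn (fun (n : ℕ) z => (deconvT μ₁ μ₃ z)^[n] z) ω atTop
      (halfPlane s) := by
    rw [Metric.tendstoUniformlyOn_iff]
    intro ε hε
    have hlim : Tendsto (fun n : ℕ => (8 * Var[id; μ₁] / s ^ 2) ^ n *
        (Var[id; μ₁] / (s / 2) + ‖((∫ t, t ∂μ₁ : ℝ) : ℂ)‖)) atTop (𝓝 0) := by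
      simpa using (tendsto_pow_atTop_nhds_zero_of_lt_one (by positivity) hq).mul_const
        (Var[id; μ₁] / (s / 2) + ‖((∫ t, t ∂μ₁ : ℝ) : ℂ)‖)
    filter_upwards [hlim.eventually_lt_const hε] with n hn z hz
    refine lt_of_le_of_lt ?_ hn
    have hz' : s < z.im := hz
    have hzD := hsub hz
    have hz0 := im_pos_of_mem_deconvDomain hzD
    rw [dist_comm, dist_eq_norm]
    refine (norm_deconvT_iterate_sub_le μ₁ μ₃ hμ₁ hzD (by linarith) (him z hzD)
      (hfix z hzD) n).trans ?_
    rw [norm_sub_rev]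
    gcongr
    refine (norm_sub_le_of_deconvT_eq μ₁ μ₃ hμ₁ hz0 (him z hzD) (hfix z hzD)).trans ?_
    gcongr
  have hd : DifferentiableOn ℂ ω (halfPlane s) :=
    hunif.tendstoLocallyUniformlyOn.differentiableOn
      (.of_forall fun n => (differentiableOn_deconvT_iterate μ₁ μ₃ hμ₁ n).mono hsub)
      (isOpen_halfPlane s)
  exact hd.analyticAt ((isOpen_halfPlane s).mem_nhds hs2)

theorem norm_hTilde_sub_sub_le (hμ₃ : MemLp id 2 μ₃) (hz : 0 < z.im)
    (hw : 3 * z.im / 4 ≤ w.im) :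
    ‖hTilde μ₃ w - z - z‖ ≤ 2 * ‖w - z‖ + (Var[id; μ₃] / (3 * z.im / 4) +
      ‖((∫ t, t ∂μ₃ : ℝ) : ℂ)‖) := by
  have hV : 0 ≤ Var[id; μ₃] := variance_nonneg _ _
  have h := norm_hTrans_sub_integral_le μ₃ hμ₃ (z := w) (by linarith)
  have e : hTilde μ₃ w - z - z
      = 2 * (w - z) - ((hTrans μ₃ w - ↑(∫ t, t ∂μ₃)) + ↑(∫ t, t ∂μ₃)) := by
    simp only [hTilde, hTrans]; ring
  rw [e]
  refine (norm_sub_le _ _).trans ?_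
  rw [norm_mul, Complex.norm_two]
  gcongr
  refine (norm_add_le _ _).trans ?_
  gcongr
  exact h.trans (by gcongr)

end

/-! ### Free additive convolution -/

theorem I_mul_mem_truncCone {α β y : ℝ} (hα : 0 < α) (hβ : 0 < β) (hy : β < y) :
    Complex.I * y ∈ truncCone α β := by
  have : 0 < y := hβ.trans hy
  refine ⟨by simpa using hy, ?_⟩
  simp
  positivity

theorem IsFInverse.tendsto_im_div {μ : Measure ℝ} {α β : ℝ} {K : ℂ → ℂ} (h : IsFInverse μ α β K)
    (hα : 0 < α) (hβ : 0 < β) :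
    Tendsto (fun y : ℝ => (K (Complex.I * y)).im / y) atTop (𝓝 1) := by
  have h1 : Tendsto (fun y : ℝ => Complex.I * (y : ℂ)) atTop
      (Bornology.cobounded ℂ ⊓ 𝓟 (truncCone α β)) := by
    refine tendsto_inf.2 ⟨?_, tendsto_principal.2 ?_⟩
    · rw [← tendsto_norm_atTop_iff_cobounded]
      refine tendsto_abs_atTop_atTop.congr fun y => ?_
      simp
    · filter_upwards [eventually_gt_atTop β] with y hy using I_mul_mem_truncCone hα hβ hy
  have h2 := (Complex.continuous_re.tendsto _).comp (h.tendsto_div.comp h1)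
  refine h2.congr' ?_
  filter_upwards [eventually_gt_atTop 0] with y hy
  simp only [Function.comp]
  rw [← div_div, Complex.div_ofReal_re, Complex.div_I]
  simp

/-- If `μ₁ ⊞ μ₂ = μ₃`, then `F_{μ₂} = F_{μ₃} ∘ ω`, where `ω(z)` is the fixed point of `T_z`. No
moment assumption on `μ₂` is needed: for `u = iy` with `y` large and `z = K₂(u)`, the point
`K₃(u)` is a fixed point of `T_z`, so both sides equal `u` at `z`; the identity theorem does the
rest. -/
theorem cauchyF_eq_of_isFreeAddConv (μ₁ μ₂ μ₃ : Measure ℝ) [IsProbabilityMeasure μ₁]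
    [IsProbabilityMeasure μ₂] [IsProbabilityMeasure μ₃] (hμ₁ : MemLp id 2 μ₁) {ω : ℂ → ℂ}
    (hω : AnalyticOnNhd ℂ ω (deconvDomain μ₁))
    (him : ∀ z ∈ deconvDomain μ₁, 3 * z.im / 4 ≤ (ω z).im)
    (hfix : ∀ z ∈ deconvDomain μ₁, deconvT μ₁ μ₃ z (ω z) = ω z)
    (hconv : IsFreeAddConv μ₁ μ₂ μ₃) :
    Set.EqOn (cauchyF μ₂) (cauchyF μ₃ ∘ ω) (deconvDomain μ₁) := by
  obtain ⟨α, β, hα, hβ, K₁, K₂, K₃, h1, h2, h3, hK⟩ := hconv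
  have t2 := h2.tendsto_im_div hα hβ
  have t3 := h3.tendsto_im_div hα hβ
  -- On the imaginary axis near infinity, `K₂` takes values in the domain, and the two functions
  -- agree there.
  have key : ∀ᶠ y : ℝ in atTop, β < y ∧ K₂ (Complex.I * y) ∈ deconvDomain μ₁ ∧
      cauchyF μ₂ (K₂ (Complex.I * y)) = (cauchyF μ₃ ∘ ω) (K₂ (Complex.I * y)) := by
    -- `3 * 1.1 / 4 < 0.9`, so `Im (K₃ u)` exceeds `3 * Im (K₂ u) / 4`.
    filter_upwards [eventually_gt_atTop β,
      t2.eventually_lt_const (show (1 : ℝ) < 11 / 10 by norm_num),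
      t2.eventually_const_lt (show (9 / 10 : ℝ) < 1 by norm_num),
      t3.eventually_const_lt (show (9 / 10 : ℝ) < 1 by norm_num),
      eventually_gt_atTop (2 * (2 * √2 * √(Var[id; μ₁])))] with y hy a2 b2 b3 hbig
    have hy0 : 0 < y := hβ.trans hy
    have hu := I_mul_mem_truncCone hα hβ hy
    rw [div_lt_iff₀ hy0] at a2
    rw [lt_div_iff₀ hy0] at b2 b3
    set u : ℂ := Complex.I * y
    have hz : K₂ u ∈ deconvDomain μ₁ := by
      show 2 * √2 * √(Var[id; μ₁]) < (K₂ u).im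
      linarith
    refine ⟨hy, hz, ?_⟩
    have hw : 3 * (K₂ u).im / 4 ≤ (K₃ u).im := by linarith
    have hF : cauchyF μ₃ (K₃ u) = cauchyF μ₁ (K₁ u) := by
      rw [h3.right_inv u hu, h1.right_inv u hu]
    have hdiff : K₁ u - K₃ u = cauchyF μ₃ (K₃ u) - K₂ u := by
      rw [h3.right_inv u hu]; linear_combination -hK u hu
    have := eq_of_deconvT_eq μ₁ μ₃ hμ₁ hz hw (him _ hz)
      (deconvT_eq_of_cauchyF_eq μ₁ μ₃ hdiff hF).2 (hfix _ hz)
    rw [Function.comp, ← this, h2.right_inv u hu, h3.right_inv u hu]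
  obtain ⟨Y, hY⟩ := eventually_atTop.1 key
  have hA2 : AnalyticOnNhd ℂ (cauchyF μ₂) (deconvDomain μ₁) :=
    DifferentiableOn.analyticOnNhd (fun z hz => (differentiableAt_cauchyF μ₂
      (im_pos_of_mem_deconvDomain hz)).differentiableWithinAt) (isOpen_deconvDomain μ₁)
  have hA3 : AnalyticOnNhd ℂ (cauchyF μ₃ ∘ ω) (deconvDomain μ₁) :=
    DifferentiableOn.analyticOnNhd (fun z hz => ((differentiableAt_cauchyF μ₃
      (by linarith [him z hz, im_pos_of_mem_deconvDomain hz])).comp z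
        (hω z hz).differentiableAt).differentiableWithinAt) (isOpen_deconvDomain μ₁)
  have hconn : IsPreconnected (deconvDomain μ₁) :=
    (convex_halfSpace_im_gt _).isPreconnected
  refine hA2.eqOn_of_preconnected_of_frequently_eq hA3 hconn (hY Y le_rfl).2.1 ?_
  -- `K₂` is injective on the cone, so these values accumulate at `K₂ (I * Y)`.
  have hcont : ContinuousAt (fun y : ℝ => K₂ (Complex.I * y)) Y :=
    ContinuousAt.comp (f := fun y : ℝ => Complex.I * (y : ℂ)) (g := K₂)
      (h2.analytic _ (I_mul_mem_truncCone hα hβ (hY Y le_rfl).1)).continuousAt (by fun_prop)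
  have hlim : Tendsto (fun y : ℝ => K₂ (Complex.I * y)) (𝓝[>] Y) (𝓝[≠] K₂ (Complex.I * Y)) := by
    refine tendsto_nhdsWithin_iff.2 ⟨hcont.tendsto.mono_left nhdsWithin_le_nhds, ?_⟩
    filter_upwards [self_mem_nhdsWithin] with y (hy : Y < y) heq
    have e := congrArg (cauchyF μ₂) (show K₂ (Complex.I * y) = K₂ (Complex.I * Y) from heq)
    rw [h2.right_inv _ (I_mul_mem_truncCone hα hβ (hY y hy.le).1),
      h2.right_inv _ (I_mul_mem_truncCone hα hβ (hY Y le_rfl).1)] at e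
    have := mul_left_cancel₀ Complex.I_ne_zero e
    exact hy.ne' (by exact_mod_cast this)
  refine hlim.frequently (Eventually.frequently ?_)
  filter_upwards [self_mem_nhdsWithin] with y (hy : Y < y) using (hY y hy.le).2.2

/-! ### The subordination functions -/

theorem theorem1p2 (μ₁ μ₃ : Measure ℝ) [IsProbabilityMeasure μ₁] [IsProbabilityMeasure μ₃]
    (hμ₁ : MemLp id 2 μ₁) (hμ₃ : MemLp id 2 μ₃) :
    -- the map `T_z` is a well-defined self-map of the half-plane `Im w > 3 Im z / 4`
    (∀ z ∈ deconvDomain μ₁, ∀ w ∈ halfPlane (3 * z.im / 4),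
      0 < (hTilde μ₃ w - z).im ∧ deconvT μ₁ μ₃ z w ∈ halfPlane (3 * z.im / 4)) ∧
    ∃ ω₁ ω₃ : ℂ → ℂ,
      -- existence of an analytic pair with the four properties
      AnalyticOnNhd ℂ ω₁ (deconvDomain μ₁) ∧ AnalyticOnNhd ℂ ω₃ (deconvDomain μ₁) ∧
      IsDeconvPair μ₁ μ₃ ω₁ ω₃ ∧
      -- the second equality of the subordination holds even if no `μ₂` exists
      (∀ z ∈ deconvDomain μ₁, cauchyF μ₃ (ω₃ z) = cauchyF μ₁ (ω₁ z)) ∧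
      -- uniqueness, among all pairs of functions with the four properties
      (∀ ω₁' ω₃' : ℂ → ℂ, IsDeconvPair μ₁ μ₃ ω₁' ω₃' →
        Set.EqOn ω₁' ω₁ (deconvDomain μ₁) ∧ Set.EqOn ω₃' ω₃ (deconvDomain μ₁)) ∧
      -- uniqueness, without reference to `μ₂` or to the iteration
      (∀ ω₁' ω₃' : ℂ → ℂ,
        SubordNormalized (deconvDomain μ₁) ω₁' → SubordNormalized (deconvDomain μ₁) ω₃' →
        (∀ z ∈ deconvDomain μ₁, ω₁' z - ω₃' z = cauchyF μ₃ (ω₃' z) - z) →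
        (∀ z ∈ deconvDomain μ₁, cauchyF μ₃ (ω₃' z) = cauchyF μ₁ (ω₁' z)) →
        Set.EqOn ω₁' ω₁ (deconvDomain μ₁) ∧ Set.EqOn ω₃' ω₃ (deconvDomain μ₁)) := by
  have hpos : ∀ z ∈ deconvDomain μ₁, 0 < z.im := fun z hz => im_pos_of_mem_deconvDomain hz
  refine ⟨fun z hz w (hw : 3 * z.im / 4 < w.im) => ⟨?_, lt_deconvT_im μ₁ μ₃ hμ₁ hz hw.le⟩, ?_⟩
  · exact (half_pos (hpos z hz)).trans_le (half_im_le_hTilde_sub_im μ₃ (hpos z hz) hw.le)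
  have hex : ∀ z, ∃ w : ℂ, z ∈ deconvDomain μ₁ →
      3 * z.im / 4 ≤ w.im ∧ deconvT μ₁ μ₃ z w = w := fun z => by
    by_cases hz : z ∈ deconvDomain μ₁
    · exact (exists_deconvT_eq μ₁ μ₃ hμ₁ hz).imp fun w hw _ => hw
    · exact ⟨0, fun h => absurd h hz⟩
  choose ω hω using hex
  have him : ∀ z ∈ deconvDomain μ₁, 3 * z.im / 4 ≤ (ω z).im := fun z hz => (hω z hz).1
  have hfix : ∀ z ∈ deconvDomain μ₁, deconvT μ₁ μ₃ z (ω z) = ω z := fun z hz => (hω z hz).2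
  have han := analyticOnNhd_of_deconvT_eq μ₁ μ₃ hμ₁ him hfix
  have hsub : ∀ z ∈ deconvDomain μ₁,
      cauchyF μ₃ (ω z) = cauchyF μ₁ (hTilde μ₃ (ω z) - z) := fun z hz =>
    cauchyF_eq_of_deconvT_eq μ₁ μ₃ (hfix z hz)
  have hV₁ : 0 ≤ Var[id; μ₁] := variance_nonneg _ _
  have hV₃ : 0 ≤ Var[id; μ₃] := variance_nonneg _ _
  have hbd : ∀ᶠ y : ℝ in atTop, ‖ω (Complex.I * y) - Complex.I * y‖
      ≤ Var[id; μ₁] / (1 / 2) + ‖((∫ t, t ∂μ₁ : ℝ) : ℂ)‖ := by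
    filter_upwards [I_mul_mem_deconvDomain_eventually μ₁, eventually_ge_atTop 1] with y hy hy1
    refine (norm_sub_le_of_deconvT_eq μ₁ μ₃ hμ₁ (hpos _ hy) (him _ hy) (hfix _ hy)).trans ?_
    have : (Complex.I * (y : ℂ)).im = y := by simp
    rw [this]
    gcongr
  refine ⟨fun z => hTilde μ₃ (ω z) - z, ω, ?_, han, ⟨⟨?_, ?_⟩, ⟨?_, ?_⟩, ?_, ?_, ?_⟩, hsub, ?_, ?_⟩
  · refine DifferentiableOn.analyticOnNhd (fun z hz => ?_) (isOpen_deconvDomain μ₁)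
    exact (((differentiableAt_hTilde μ₃ (by linarith [him z hz, hpos z hz])).comp z
      (han z hz).differentiableAt).sub differentiableAt_id).differentiableWithinAt
  · exact fun z hz => half_im_le_hTilde_sub_im μ₃ (hpos z hz) (him z hz)
  · refine tendsto_div_I_mul_of_norm_sub_le (f := fun z => hTilde μ₃ (ω z) - z)
      (C := 2 * (Var[id; μ₁] / (1 / 2) +
      ‖((∫ t, t ∂μ₁ : ℝ) : ℂ)‖) + (Var[id; μ₃] / (3 / 4) + ‖((∫ t, t ∂μ₃ : ℝ) : ℂ)‖)) ?_
    filter_upwards [hbd, I_mul_mem_deconvDomain_eventually μ₁, eventually_ge_atTop 1]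
      with y hb hy hy1
    refine (norm_hTilde_sub_sub_le μ₃ hμ₃ (hpos _ hy) (him _ hy)).trans ?_
    have : (Complex.I * (y : ℂ)).im = y := by simp
    rw [this]
    gcongr
    linarith
  · exact fun z hz => by linarith [him z hz, hpos z hz]
  · exact tendsto_div_I_mul_of_norm_sub_le hbd
  · exact fun μ₂ _ hconv z hz =>
      ⟨cauchyF_eq_of_isFreeAddConv μ₁ μ₂ μ₃ hμ₁ han him hfix hconv hz, hsub z hz⟩
  · exact fun z _ => by simp only [hTilde]; ring
  · exact fun z hz w (hw : 3 * z.im / 4 < w.im) =>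
      tendsto_deconvT_iterate μ₁ μ₃ hμ₁ hz hw.le (him z hz) (hfix z hz)
  · intro ω₁' ω₃' h'
    have h3 : Set.EqOn ω₃' ω (deconvDomain μ₁) := fun z hz => by
      have hz34 : 3 * z.im / 4 < z.im := by linarith [hpos z hz]
      exact tendsto_nhds_unique (h'.iterate z hz z hz34)
        (tendsto_deconvT_iterate μ₁ μ₃ hμ₁ hz hz34.le (him z hz) (hfix z hz))
    refine ⟨fun z hz => ?_, h3⟩
    have hd := h'.diff z hz
    rw [h3 hz] at hd
    simp only [hTilde]
    linear_combination hd
  · intro ω₁' ω₃' hn₁ _ hd hF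
    have h' := fun z hz => deconvT_eq_of_cauchyF_eq μ₁ μ₃ (hd z hz) (hF z hz)
    have h3 : Set.EqOn ω₃' ω (deconvDomain μ₁) := fun z hz => by
      refine eq_of_deconvT_eq μ₁ μ₃ hμ₁ hz ?_ (him z hz) (h' z hz).2 (hfix z hz)
      -- The bound `Im ω₁' ≥ Im z / 2` alone puts `ω₃'` into the half-plane `Im w > 3 Im z / 4`.
      have := (lt_hTrans_add_im μ₁ hμ₁ hz (hn₁.1 z hz)).le
      rwa [← (h' z hz).1, ← deconvT, (h' z hz).2] at this
    refine ⟨fun z hz => ?_, h3⟩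
    rw [← (h' z hz).1, h3 hz]
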